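/- Let $S_n$ be the symmetric group on $\{1,\dots,n\}$, with permutations composed as functions; let $s_i=(i\ i+1)$ for $1\le i\le n-1$ and $t_{ij}=(i\ j)$ for $i<j$. Let $\ell(w)$ be the least number of simple transpositions $s_i$ with product $w$. Put $N=\binom n2$, let $\varepsilon$ be the identity, and let $w_0$ be the permutation with one-line notation $n,n-1,\dots,1$. The weak order on $S_n$ has the covering relations $w\lessdot_W u$ if and only if $u=ws_i$ for some $i$ and $\ell(u)=\ell(w)+1$; the strong order has the covering relations $w\lessdot_S u$ if and only if $u=wt_{ij}$ for some $i<j$ and $\ell(u)=\ell(w)+1$. The $\nabla$-weight of a weak cover $w\lessdot_W ws_i$ is $i$. The code weight of a strong cover $w\lessdot_S u$ is the Manhattan distance $\sum_i|\mathrm{code}(w)_i-\mathrm{code}(u)_i|$, where $\mathrm{code}(w)_i=\#\{j>i : w(j)<w(i)\}$. Let $m_\nabla(x,y)$ (respectively $m_\Delta(x,y)$) be the sum, over all saturated chains from $x$ to $y$ in the weak order (respectively in the strong order), of the product of the $\nabla$-weights (respectively code weights) of the covers of the chain. The Schubert polynomials $\mathfrak S_w$, $w\in S_n$, are defined by $\mathfrak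 S_{w_0}=x_1^{n-1}x_2^{n-2}\cdots x_{n-1}$ and $\mathfrak S_{s_iw}=N_i\,\mathfrak S_w$ whenever $\ell(s_iw)<\ell(w)$, where $N_i g=\dfrac{g-s_i\cdot g}{x_i-x_{i+1}}$ and $s_i$ acts on a polynomial by interchanging $x_i$ and $x_{i+1}$. Theorem. For every $u\in S_n$, $$\frac{m_\Delta(u,w_0)}{(N-\ell(u))!}=\frac{m_\nabla(\varepsilon,u)}{\ell(u)!}=\mathfrak S_u(1,\dots,1)=\frac{m_\Delta(\varepsilon,w_0u)}{(N-\ell(u))!}=\frac{m_\nabla(w_0u,w_0)}{\ell(u)!}.$$ In particular, $m_\Delta(\varepsilon,w_0)=N!$. -/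

import Mathlib

open Equiv

namespace BruhatPaths

/-! Permutations of `{1, …, n}` are elements of `Equiv.Perm (Fin n)`, multiplied as functions,
`(u * v) i = u (v i)`. All indices are shifted by one: the position `i : Fin n` stands for `i + 1`,
and `i : Fin (n - 1)` stands for the index `i + 1` of a simple transposition. -/

/-- The position `i`, for `i` an index of a simple transposition. -/
def lo {n : ℕ} (i : Fin (n - 1)) : Fin n := ⟨i, by omega⟩

/-- The position following `lo i`. -/
def hi {n : ℕ} (i : Fin (n - 1)) : Fin n := ⟨i + 1, by omega⟩

/-- The simple transposition `s_i`, exchanging two adjacent positions. -/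
def simple {n : ℕ} (i : Fin (n - 1)) : Perm (Fin n) := swap (lo i) (hi i)

/-- The simple transpositions generate: every permutation is the product of some word, so that
the infimum in `length` below is over a nonempty set. -/
theorem exists_word {n : ℕ} (w : Perm (Fin n)) :
    ∃ a : List (Fin (n - 1)), (a.map simple).prod = w := by
  cases n with
  | zero => exact ⟨[], Subsingleton.elim _ _⟩
  | succ m =>
    have hw : w ∈ Submonoid.closure (Set.range fun i : Fin m => swap i.castSucc i.succ) := by
      rw [Equiv.Perm.mclosure_swap_castSucc_succ]; trivial
    induction hw using Submonoid.closure_induction with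
    | mem x hx =>
      obtain ⟨i, rfl⟩ := hx
      exact ⟨[i], by simp [simple, lo, hi]; rfl⟩
    | one => exact ⟨[], rfl⟩
    | mul x y _ _ hx hy =>
      obtain ⟨a, ha⟩ := hx
      obtain ⟨b, hb⟩ := hy
      exact ⟨a ++ b, by rw [List.map_append, List.prod_append, ha, hb]⟩

/-- The length `ℓ(w)`: the smallest `k` such that `w` is a product of `k` simple transpositions. -/
noncomputable def length {n : ℕ} (w : Perm (Fin n)) : ℕ :=
  sInf {k | ∃ a : List (Fin (n - 1)), a.length = k ∧ (a.map simple).prod = w}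

/-- The permutation `w₀` with one-line notation `n, n - 1, …, 1`. -/
def longest (n : ℕ) : Perm (Fin n) := Fin.revPerm

/-- The covering relation of the weak order: `u = w s_i` and `ℓ(u) = ℓ(w) + 1`. -/
def WeakCover {n : ℕ} (w u : Perm (Fin n)) : Prop :=
  (∃ i : Fin (n - 1), u = w * simple i) ∧ length u = length w + 1

/-- The covering relation of the strong order: `u = w t_{ij}` and `ℓ(u) = ℓ(w) + 1`. -/
def StrongCover {n : ℕ} (w u : Perm (Fin n)) : Prop :=
  (∃ i j : Fin n, i < j ∧ u = w * swap i j) ∧ length u = length w + 1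

/-- The Lehmer code: `code w i` is the number of `j > i` with `w j < w i`. (The entry at the last
position is always `0`.) -/
def code {n : ℕ} (w : Perm (Fin n)) (i : Fin n) : ℕ :=
  (Finset.univ.filter fun j : Fin n => i < j ∧ w j < w i).card

/-- The code weight of `(w, u)`: the Manhattan distance between the codes of `w` and `u`. -/
def codeWeight {n : ℕ} (w u : Perm (Fin n)) : ℕ :=
  ∑ i : Fin n, ((code w i : ℤ) - (code u i : ℤ)).natAbs

/-- The `∇`-weight of `(w, u)`: it is `i` (in one-based numbering) if `u = w s_i`. -/
def nablaWeight {n : ℕ} (w u : Perm (Fin n)) : ℕ :=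
  ∑ i : Fin (n - 1), if u = w * simple i then (i : ℕ) + 1 else 0

open Classical in
/-- The saturated chains `x = c₀ ⋖ c₁ ⋖ ⋯ ⋖ c_k = y` with `k` steps for a covering relation. -/
noncomputable def chains {α : Type*} [Fintype α] (cov : α → α → Prop) (x y : α) (k : ℕ) :
    Finset (Fin (k + 1) → α) :=
  Finset.univ.filter fun c =>
    c 0 = x ∧ c (Fin.last k) = y ∧ ∀ i : Fin k, cov (c i.castSucc) (c i.succ)

/-- The number of weighted paths from `x` to `y`: the sum over all saturated chains from `x` to `y`
of the product of the weights of their steps. The elements of a chain in a poset are distinct, so a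
chain has fewer steps than the (finite) poset has elements. -/
noncomputable def weightedPaths {α : Type*} [Fintype α] (cov : α → α → Prop) (wt : α → α → ℕ)
    (x y : α) : ℕ :=
  ∑ k ∈ Finset.range (Fintype.card α), ∑ c ∈ chains cov x y k,
    ∏ i : Fin k, wt (c i.castSucc) (c i.succ)

/-- `m_Δ(x, y)`: weighted paths in the strong order with the code weights. -/
noncomputable def mDelta {n : ℕ} (x y : Perm (Fin n)) : ℕ :=
  weightedPaths StrongCover codeWeight x y

/-- `m_∇(x, y)`: weighted paths in the weak order with the `∇`-weights. -/
noncomputable def mNabla {n : ℕ} (x y : Perm (Fin n)) : ℕ :=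
  weightedPaths WeakCover nablaWeight x y

/-- The divided difference is a polynomial. -/
theorem sub_dvd_sub_swap {n : ℕ} (a b : Fin n) (g : MvPolynomial (Fin n) ℂ) :
    (MvPolynomial.X a - MvPolynomial.X b) ∣ g - MvPolynomial.rename (swap a b) g := by
  induction g using MvPolynomial.induction_on with
  | C r => simp
  | add p q hp hq =>
    have h := dvd_add hp hq
    rw [map_add]
    convert h using 1
    ring
  | mul_X p j hp =>
    have hX : (MvPolynomial.X a - MvPolynomial.X b : MvPolynomial (Fin n) ℂ) ∣
        MvPolynomial.X j - MvPolynomial.X (swap a b j) := by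
      rcases eq_or_ne j a with rfl | ha
      · rw [swap_apply_left]
      · rcases eq_or_ne j b with rfl | hb
        · rw [swap_apply_right]
          exact ⟨-1, by ring⟩
        · rw [swap_apply_of_ne_of_ne ha hb, sub_self]
          exact dvd_zero _
    rw [map_mul, MvPolynomial.rename_X]
    have h := dvd_add (hp.mul_right (MvPolynomial.X j))
      (hX.mul_left (MvPolynomial.rename (swap a b) p))
    convert h using 1
    ring

/-- The Newton divided difference `N_i g = (g - s_i g) / (x_i - x_{i+1})`, on polynomials in
`x_1, …, x_n`; the quotient is exact, and unique as the polynomial ring is a domain. -/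
noncomputable def dividedDifference {n : ℕ} (i : Fin (n - 1)) (g : MvPolynomial (Fin n) ℂ) :
    MvPolynomial (Fin n) ℂ :=
  (sub_dvd_sub_swap (lo i) (hi i) g).choose

/-- The defining equation of the divided difference. -/
theorem dividedDifference_spec {n : ℕ} (i : Fin (n - 1)) (g : MvPolynomial (Fin n) ℂ) :
    (MvPolynomial.X (lo i) - MvPolynomial.X (hi i)) * dividedDifference i g =
      g - MvPolynomial.rename (simple i) g :=
  (sub_dvd_sub_swap (lo i) (hi i) g).choose_spec.symm

open Classical in
/-- The Schubert polynomials, by recursion downwards from `w₀`: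
`𝔖_{w₀} = x_1^{n-1} x_2^{n-2} ⋯ x_{n-1}`, and `𝔖_w = N_i 𝔖_{s_i w}` for an index `i` with
`ℓ(w) < ℓ(s_i w)`. Such an `i` exists for each `w ≠ w₀`, and the result does not depend on it
because the `N_i` satisfy the braid relations. -/
noncomputable def schubert {n : ℕ} (w : Perm (Fin n)) : MvPolynomial (Fin n) ℂ :=
  if w = longest n then ∏ i : Fin n, MvPolynomial.X i ^ (n - 1 - (i : ℕ))
  else if h : ∃ i : Fin (n - 1), length w < length (simple i * w) then
    dividedDifference h.choose (schubert (simple h.choose * w))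
  else 0
termination_by (Finset.univ.filter fun v : Perm (Fin n) => length w < length v).card
decreasing_by
  have hi := h.choose_spec
  refine Finset.card_lt_card (Finset.ssubset_iff_of_subset ?_ |>.2 ⟨simple h.choose * w, ?_, ?_⟩)
  · intro v hv
    simp only [Finset.mem_filter, Finset.mem_univ, true_and] at hv ⊢
    exact hi.trans hv
  · simpa using hi
  · simp

end BruhatPaths

namespace BruhatPaths

variable {n : ℕ}

/-! Put f(u) = 𝔖_u(1, …, 1), and let D and U be the weight matrices of the weak and strong orders.
Everything follows from the recurrence Dᵀf = ℓ·f together with f(1) = f(w₀) = 1.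

The recurrence comes from ∇ = ∑ ∂/∂x_i. It commutes with the divided differences, so the formula
∇𝔖_u = ∑ k 𝔖_{u s_k}, over the descents k of u, need only be checked at w₀ and then descends
(`nabla_schubert`). At (1, …, 1), ∇ agrees with the Euler operator ∑ x_i ∂/∂x_i, which multiplies
𝔖_u by its degree ℓ(u). Iterating the recurrence down to the identity gives m_∇(ε, u) = ℓ(u)! f(u).

The strong order enters through the sl₂-type relation DᵀU − UDᵀ = diag(2ℓ − N)
(`weak_strong_commutator`). Off the diagonal its terms cancel in pairs. On the diagonal, summation
by parts of the code yields 2ℓ − N. Applying the relation to f, induction on length gives Uf = (N −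
ℓ)·f (`sum_strong_mul_eq`); iterating up to w₀ gives m_Δ(u, w₀) = (N − ℓ(u))! f(u).

Left multiplication by w₀ reverses both orders and preserves both weights, which gives the other two
expressions. -/

/-! ### Simple transpositions. -/

theorem lo_lt_hi (k : Fin (n - 1)) : lo k < hi k := by simp [lo, hi, Fin.lt_def]

theorem hi_le_iff (k : Fin (n - 1)) (j : Fin n) : hi k ≤ j ↔ lo k < j := by
  simp only [lo, hi, Fin.lt_def, Fin.le_def]; omega

@[simp] theorem simple_lo (k : Fin (n - 1)) : simple k (lo k) = hi k := swap_apply_left _ _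

@[simp] theorem simple_hi (k : Fin (n - 1)) : simple k (hi k) = lo k := swap_apply_right _ _

theorem simple_of_ne {k : Fin (n - 1)} {i : Fin n} (h₁ : i ≠ lo k) (h₂ : i ≠ hi k) :
    simple k i = i := swap_apply_of_ne_of_ne h₁ h₂

@[simp] theorem simple_mul_self (k : Fin (n - 1)) : simple k * simple k = 1 := swap_mul_self _ _

@[simp] theorem simple_inv (k : Fin (n - 1)) : (simple k)⁻¹ = simple k := swap_inv _ _

@[simp] theorem simple_simple (k : Fin (n - 1)) (i : Fin n) : simple k (simple k i) = i := by
  rw [← Perm.mul_apply, simple_mul_self, Perm.one_apply]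

@[simp] theorem mul_simple_simple (w : Perm (Fin n)) (k : Fin (n - 1)) :
    w * simple k * simple k = w := by rw [mul_assoc, simple_mul_self, mul_one]

@[simp] theorem simple_mul_simple_mul (w : Perm (Fin n)) (k : Fin (n - 1)) :
    simple k * (simple k * w) = w := by rw [← mul_assoc, simple_mul_self, one_mul]

theorem val_simple (k : Fin (n - 1)) (i : Fin n) :
    (simple k i : ℕ) = if (i : ℕ) = k then (k : ℕ) + 1 else if (i : ℕ) = k + 1 then (k : ℕ)
      else i := by
  simp only [simple, swap_apply_def, lo, hi, Fin.ext_iff]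
  split_ifs <;> rfl

theorem simple_injective : Function.Injective (simple : Fin (n - 1) → Perm (Fin n)) := by
  intro k l h
  have h1 := val_simple l (lo k)
  rw [← h, simple_lo] at h1
  by_contra hne
  rw [lo, hi, if_neg fun e => hne (Fin.ext e)] at h1
  dsimp only at h1
  split_ifs at h1 <;> omega

/-- The simple transposition at `k` preserves the order of every pair but its own. -/
theorem simple_lt_simple {k : Fin (n - 1)} {a b : Fin n} (hab : a < b)
    (h : ¬(a = lo k ∧ b = hi k)) : simple k a < simple k b := by
  simp only [Fin.lt_def, val_simple, Fin.ext_iff, lo, hi] at *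
  split_ifs <;> omega

/-! ### Codes, inversions and length. -/

/-- Right multiplication by a simple transposition at an ascent exchanges two entries of the code
and raises one of them by one. -/
theorem code_mul_simple {w : Perm (Fin n)} {k : Fin (n - 1)} (h : w (lo k) < w (hi k))
    (i : Fin n) :
    code (w * simple k) (simple k i) = code w i + if i = hi k then 1 else 0 := by
  have key : code (w * simple k) (simple k i) =
      (Finset.univ.filter fun j : Fin n => simple k i < simple k j ∧ w j < w i).card := by
    unfold code
    refine Finset.card_bij' (fun j _ => simple k j) (fun j _ => simple k j) ?_ ?_ ?_ ?_ <;> simp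
  rw [key]
  by_cases hi' : i = hi k
  · subst hi'
    rw [if_pos rfl, code, ← Finset.card_insert_of_notMem (a := lo k)
      (s := Finset.univ.filter fun j : Fin n => hi k < j ∧ w j < w (hi k))]
    · congr 1
      ext j
      simp only [Finset.mem_filter, Finset.mem_univ, true_and, Finset.mem_insert]
      constructor
      · rintro ⟨h1, h2⟩
        by_cases hj : j = lo k
        · exact Or.inl hj
        · refine Or.inr ⟨?_, h2⟩
          have hj' : j ≠ hi k := by rintro rfl; exact h2.ne rfl
          rw [simple_hi, simple_of_ne hj hj'] at h1
          exact lt_of_le_of_ne ((hi_le_iff k j).2 h1) hj'.symm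
      · rintro (rfl | ⟨h1, h2⟩)
        · simpa using ⟨lo_lt_hi k, h⟩
        · refine ⟨simple_lt_simple h1 fun hh => (lo_lt_hi k).ne hh.1.symm, h2⟩
    · simp [(lo_lt_hi k).not_gt]
  · rw [if_neg hi', add_zero, code]
    congr 1
    ext j
    simp only [Finset.mem_filter, Finset.mem_univ, true_and, and_congr_left_iff]
    intro h2
    constructor
    · intro h1
      have := simple_lt_simple (k := k) h1 (by
        rintro ⟨e1, e2⟩
        apply hi'; rw [← simple_lo, ← e1, simple_simple])
      simpa using this
    · intro h1
      refine simple_lt_simple h1 ?_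
      rintro ⟨rfl, rfl⟩
      exact h.not_gt h2

theorem sum_code_mul_simple {w : Perm (Fin n)} {k : Fin (n - 1)} (h : w (lo k) < w (hi k)) :
    ∑ i, code (w * simple k) i = ∑ i, code w i + 1 := by
  rw [← Equiv.sum_comp (simple k)]
  simp [code_mul_simple h, Finset.sum_add_distrib]

theorem ascent_or_descent (w : Perm (Fin n)) (k : Fin (n - 1)) :
    w (lo k) < w (hi k) ∨ w (hi k) < w (lo k) :=
  lt_or_gt_of_ne fun h => (lo_lt_hi k).ne (w.injective h)

theorem sum_code_mul_simple' {w : Perm (Fin n)} {k : Fin (n - 1)} (h : w (hi k) < w (lo k)) :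
    ∑ i, code (w * simple k) i + 1 = ∑ i, code w i := by
  have := sum_code_mul_simple (w := w * simple k) (k := k) (by simpa using h)
  rw [← this, mul_simple_simple]

theorem strictMono_of_lo_lt_hi {α : Type*} [Preorder α] {f : Fin n → α}
    (h : ∀ k, f (lo k) < f (hi k)) : StrictMono f := by
  cases n with
  | zero => exact fun a => a.elim0
  | succ m => exact Fin.strictMono_iff_lt_succ.2 h

theorem eq_one_of_forall_ascent {w : Perm (Fin n)} (h : ∀ k, w (lo k) < w (hi k)) : w = 1 := by
  have hs := strictMono_of_lo_lt_hi h
  have : (hs.orderIsoOfSurjective _ w.surjective) = OrderIso.refl _ := Subsingleton.elim _ _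
  ext i
  have := congrArg (fun e => e i) this
  simpa using congrArg Fin.val this

theorem code_one (i : Fin n) : code (1 : Perm (Fin n)) i = 0 := by
  simp only [code, Finset.card_eq_zero, Finset.filter_eq_empty_iff]
  rintro j - ⟨h1, h2⟩
  exact h1.not_gt h2

theorem length_le_of_word (a : List (Fin (n - 1))) : length (a.map simple).prod ≤ a.length :=
  Nat.sInf_le ⟨a, rfl, rfl⟩

theorem exists_reduced_word (w : Perm (Fin n)) :
    ∃ a : List (Fin (n - 1)), a.length = length w ∧ (a.map simple).prod = w := by
  obtain ⟨a, ha⟩ := exists_word w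
  exact Nat.sInf_mem (s := {k | ∃ a : List (Fin (n - 1)), a.length = k ∧ (a.map simple).prod = w})
    ⟨_, a, rfl, ha⟩

/-- Each further letter changes the number of inversions by exactly one, up or down. -/
theorem sum_code_le_of_word (a : List (Fin (n - 1))) :
    ∑ i, code (a.map simple).prod i ≤ a.length := by
  induction a using List.reverseRecOn with
  | nil => simp [code_one]
  | append_singleton a k ih =>
    simp only [List.map_append, List.map_cons, List.map_nil, List.prod_append, List.prod_singleton,
      List.length_append, List.length_singleton]
    rcases ascent_or_descent (a.map simple).prod k with h | h
    · rw [sum_code_mul_simple h]; omega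
    · have := sum_code_mul_simple' h; omega

/-- The length is the number of inversions. -/
theorem length_eq_sum_code (w : Perm (Fin n)) : length w = ∑ i, code w i := by
  apply le_antisymm
  -- Sorting: as long as there is a descent, undoing it removes one inversion and costs one letter.
  · induction hm : ∑ i, code w i using Nat.strong_induction_on generalizing w with
    | _ m ih =>
      by_cases h : ∀ k, w (lo k) < w (hi k)
      · rw [eq_one_of_forall_ascent h]
        exact (length_le_of_word []).trans (Nat.zero_le _)
      · push Not at h
        obtain ⟨k, hk⟩ := h
        have hk := (ascent_or_descent w k).resolve_left hk.not_gt
        have h1 := sum_code_mul_simple' hk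
        have h2 := ih _ (by omega) (w * simple k) rfl
        obtain ⟨a, ha, hw⟩ := exists_reduced_word (w * simple k)
        have h3 := length_le_of_word (a ++ [k])
        simp only [List.map_append, hw, List.map_cons, List.map_nil, List.prod_append,
          List.prod_singleton, List.length_append, List.length_singleton, mul_simple_simple] at h3
        omega
  · obtain ⟨a, ha, hw⟩ := exists_reduced_word w
    rw [← ha, ← hw]
    exact sum_code_le_of_word a

theorem length_mul_simple {w : Perm (Fin n)} {k : Fin (n - 1)} (h : w (lo k) < w (hi k)) :
    length (w * simple k) = length w + 1 := by
  rw [length_eq_sum_code, length_eq_sum_code, sum_code_mul_simple h]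

theorem length_mul_simple' {w : Perm (Fin n)} {k : Fin (n - 1)} (h : w (hi k) < w (lo k)) :
    length (w * simple k) + 1 = length w := by
  rw [length_eq_sum_code, length_eq_sum_code, sum_code_mul_simple' h]

theorem length_lt_mul_simple_iff {w : Perm (Fin n)} {k : Fin (n - 1)} :
    length w < length (w * simple k) ↔ w (lo k) < w (hi k) := by
  rcases ascent_or_descent w k with h | h
  · simp [h, length_mul_simple h]
  · have := length_mul_simple' h
    simp only [h.not_gt, iff_false]; omega

theorem length_mul_simple_lt_iff {w : Perm (Fin n)} {k : Fin (n - 1)} :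
    length (w * simple k) < length w ↔ w (hi k) < w (lo k) := by
  rcases ascent_or_descent w k with h | h
  · simp [h.not_gt, length_mul_simple h]
  · have := length_mul_simple' h
    simp only [h, iff_true]; omega

theorem length_one : length (1 : Perm (Fin n)) = 0 := by
  simp [length_eq_sum_code, code_one]

theorem length_inv (w : Perm (Fin n)) : length w⁻¹ = length w := by
  have key : ∀ v : Perm (Fin n), length v⁻¹ ≤ length v := by
    intro v
    obtain ⟨a, ha, hv⟩ := exists_reduced_word v
    have := length_le_of_word a.reverse
    rw [List.length_reverse, ha] at this
    convert this using 2
    rw [← hv, List.prod_inv_reverse, List.map_map, List.map_reverse]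
    congr 2
  exact le_antisymm (key w) (by simpa using key w⁻¹)

theorem length_simple_mul (w : Perm (Fin n)) (k : Fin (n - 1)) :
    length (simple k * w) = length (w⁻¹ * simple k) := by
  rw [← length_inv, mul_inv_rev, simple_inv]

/-- Exchanging the entries of a non-inversion raises the length. -/
theorem length_lt_mul_swap {a b : Fin n} (hab : a < b) {w : Perm (Fin n)} (h : w a < w b) :
    length w < length (w * swap a b) := by
  obtain ⟨d, hd⟩ : ∃ d : ℕ, (b : ℕ) = a + 1 + d := ⟨b - a - 1, by rw [Fin.lt_def] at hab; omega⟩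
  induction d generalizing a w with
  | zero =>
    have hb := b.2
    obtain ⟨k, rfl, rfl⟩ : ∃ k : Fin (n - 1), a = lo k ∧ b = hi k :=
      ⟨⟨a, by omega⟩, rfl, Fin.ext (by simpa [hi] using hd)⟩
    exact length_lt_mul_simple_iff.2 h
  | succ d ih =>
    have hb := b.2
    obtain ⟨k, rfl⟩ : ∃ k : Fin (n - 1), a = lo k := ⟨⟨a, by omega⟩, rfl⟩
    have hkb : hi k < b := by simp only [hi, lo, Fin.lt_def] at *; omega
    have hsb : simple k b = b := simple_of_ne hab.ne' hkb.ne'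
    -- Conjugation by `s_k` brings the two positions one step closer, which drives the induction on
    -- their distance.
    have hconj : simple k * swap (hi k) b * simple k = swap (lo k) b := by
      have := swap_apply_apply (simple k) (hi k) b
      rw [simple_hi, hsb, simple_inv] at this
      rw [this]
    have h1 := ih (a := hi k) (w := w * simple k) hkb (by simpa [hsb] using h)
      (by simp only [hi, lo] at *; omega)
    have e : w * swap (lo k) b = w * simple k * swap (hi k) b * simple k := by
      rw [← hconj]; simp only [mul_assoc]
    rw [e]
    -- At an ascent the first two factors gain at least two and the last loses at most one. At a
    -- descent the first factor loses one, the middle one recovers it, and the last factor is again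
    -- an ascent.
    rcases ascent_or_descent w k with hk | hk
    · have h2 := length_mul_simple hk
      rcases ascent_or_descent (w * simple k * swap (hi k) b) k with h3 | h3
      · have := length_mul_simple h3; omega
      · have := length_mul_simple' h3; omega
    · have h2 := length_mul_simple' hk
      have h3 : (w * simple k * swap (hi k) b) (lo k) < (w * simple k * swap (hi k) b) (hi k) := by
        simp only [Perm.mul_apply, swap_apply_left, hsb,
          swap_apply_of_ne_of_ne (lo_lt_hi k).ne hab.ne, simple_lo]
        exact hk.trans h
      have := length_mul_simple h3; omega

theorem length_lt_mul_swap_iff {a b : Fin n} (hab : a < b) {w : Perm (Fin n)} :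
    length w < length (w * swap a b) ↔ w a < w b := by
  refine ⟨fun h => ?_, length_lt_mul_swap hab⟩
  by_contra hc
  have hne : w a ≠ w b := fun e => hab.ne (w.injective e)
  have := length_lt_mul_swap hab (w := w * swap a b)
    (by simpa using lt_of_le_of_ne (not_lt.1 hc) hne.symm)
  rw [mul_assoc, swap_mul_self, mul_one] at this
  omega

/-! ### The longest element. -/

theorem longest_apply (i : Fin n) : longest n i = Fin.rev i := rfl

theorem longest_mul_longest : longest n * longest n = 1 := by
  ext i; simp [longest]

theorem longest_mul_longest_mul (u : Perm (Fin n)) : longest n * (longest n * u) = u := by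
  rw [← mul_assoc, longest_mul_longest, one_mul]

/-- Left multiplication by `w₀` reverses every comparison of values, so each `j > i` is counted in
exactly one of the two codes. -/
theorem code_add_code_longest_mul (w : Perm (Fin n)) (i : Fin n) :
    code w i + code (longest n * w) i = n - 1 - i := by
  simp only [code, Perm.mul_apply, longest_apply, Fin.rev_lt_rev]
  rw [← Finset.card_union_of_disjoint, ← Finset.filter_or, ← Fin.card_Ioi]
  · congr 1
    ext j
    simp only [← and_or_left, Finset.mem_filter, Finset.mem_univ, true_and, Finset.mem_Ioi,
      and_iff_left_iff_imp]
    exact fun h => lt_or_gt_of_ne fun e => h.ne' (w.injective e)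
  · rw [Finset.disjoint_filter]
    rintro j - ⟨_, h⟩ ⟨_, h'⟩
    exact h.not_gt h'

theorem sum_staircase : ∑ i : Fin n, (n - 1 - (i : ℕ)) = n.choose 2 := by
  rw [Fin.sum_univ_eq_sum_range (fun i => n - 1 - i), Finset.sum_range_reflect (fun i => i),
    Finset.sum_range_id, Nat.choose_two_right]

theorem length_add_length_longest_mul (w : Perm (Fin n)) :
    length w + length (longest n * w) = n.choose 2 := by
  simp only [length_eq_sum_code, ← Finset.sum_add_distrib, code_add_code_longest_mul, sum_staircase]

theorem length_longest : length (longest n) = n.choose 2 := by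
  simpa [length_one] using length_add_length_longest_mul (1 : Perm (Fin n))

theorem length_le (w : Perm (Fin n)) : length w ≤ n.choose 2 := by
  have := length_add_length_longest_mul w; omega

theorem eq_longest_of_forall_descent {w : Perm (Fin n)} (h : ∀ k, w (hi k) < w (lo k)) :
    w = longest n := by
  have : longest n * w = 1 := eq_one_of_forall_ascent fun k => by
    simpa [longest_apply] using h k
  rw [← longest_mul_longest_mul w, this, mul_one]

/-! ### Weight matrices of the two orders. -/

open Classical in
/-- The matrix of weights of a covering relation. -/
noncomputable def coverMatrix {α : Type*} (cov : α → α → Prop) (wt : α → α → ℕ) :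
    Matrix α α ℤ :=
  Matrix.of fun x y => if cov x y then (wt x y : ℤ) else 0

theorem nablaWeight_mul_simple (w : Perm (Fin n)) (k : Fin (n - 1)) :
    nablaWeight w (w * simple k) = k + 1 := by
  rw [nablaWeight, Finset.sum_eq_single k]
  · simp
  · intro l _ hl
    rw [if_neg]
    exact fun h => hl (simple_injective (mul_left_cancel h)).symm
  · simp

theorem weakCover_mul_simple_iff {w : Perm (Fin n)} {k : Fin (n - 1)} :
    WeakCover w (w * simple k) ↔ w (lo k) < w (hi k) := by
  constructor
  · rintro ⟨-, h⟩
    exact length_lt_mul_simple_iff.1 (by omega)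
  · exact fun h => ⟨⟨k, rfl⟩, length_mul_simple h⟩

/-- A row sum of the matrix of the weak order. -/
theorem sum_weak_mul (u : Perm (Fin n)) {R : Type*} [CommRing R] (F : Perm (Fin n) → R) :
    ∑ w, ((coverMatrix WeakCover nablaWeight u w : ℤ) : R) * F w =
      ∑ k : Fin (n - 1), if u (lo k) < u (hi k) then ((k : R) + 1) * F (u * simple k) else 0 := by
  classical
  have hinj : Function.Injective fun k : Fin (n - 1) => u * simple k :=
    fun k l h => simple_injective (mul_left_cancel h)
  rw [← Finset.sum_subset (Finset.subset_univ (Finset.univ.image fun k => u * simple k)),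
    Finset.sum_image fun a _ b _ h => hinj h]
  · refine Finset.sum_congr rfl fun k _ => ?_
    simp only [coverMatrix, Matrix.of_apply, weakCover_mul_simple_iff, nablaWeight_mul_simple]
    split_ifs <;> simp
  · intro w _ hw
    rw [coverMatrix, Matrix.of_apply, if_neg, Int.cast_zero, zero_mul]
    rintro ⟨⟨k, rfl⟩, -⟩
    exact hw (Finset.mem_image_of_mem _ (Finset.mem_univ k))

/-- A column sum of the matrix of the weak order. -/
theorem sum_weak_mul' (u : Perm (Fin n)) {R : Type*} [CommRing R] (F : Perm (Fin n) → R) :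
    ∑ w, ((coverMatrix WeakCover nablaWeight w u : ℤ) : R) * F w =
      ∑ k : Fin (n - 1), if u (hi k) < u (lo k) then ((k : R) + 1) * F (u * simple k) else 0 := by
  classical
  have hinj : Function.Injective fun k : Fin (n - 1) => u * simple k :=
    fun k l h => simple_injective (mul_left_cancel h)
  rw [← Finset.sum_subset (Finset.subset_univ (Finset.univ.image fun k => u * simple k)),
    Finset.sum_image fun a _ b _ h => hinj h]
  · refine Finset.sum_congr rfl fun k _ => ?_
    have h1 := weakCover_mul_simple_iff (w := u * simple k) (k := k)
    have h2 := nablaWeight_mul_simple (u * simple k) k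
    rw [mul_simple_simple] at h1 h2
    simp only [coverMatrix, Matrix.of_apply, h1, h2, Perm.mul_apply, simple_lo, simple_hi]
    split_ifs <;> simp
  · intro w _ hw
    rw [coverMatrix, Matrix.of_apply, if_neg, Int.cast_zero, zero_mul]
    rintro ⟨⟨k, rfl⟩, -⟩
    exact hw (Finset.mem_image.2 ⟨k, Finset.mem_univ k, by simp⟩)

/-! ### The commutation relation. -/

/-- The code weight is unchanged when both ends are multiplied by a common ascent. -/
theorem codeWeight_mul_simple {x v : Perm (Fin n)} {k : Fin (n - 1)} (hx : x (lo k) < x (hi k))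
    (hv : v (lo k) < v (hi k)) : codeWeight (x * simple k) (v * simple k) = codeWeight x v := by
  rw [codeWeight, ← Equiv.sum_comp (simple k), codeWeight]
  refine Finset.sum_congr rfl fun i _ => ?_
  rw [code_mul_simple hx, code_mul_simple hv]
  push_cast
  ring_nf

theorem code_lo_le_code_hi {w : Perm (Fin n)} {k : Fin (n - 1)} (h : w (lo k) < w (hi k)) :
    code w (lo k) ≤ code w (hi k) := by
  refine Finset.card_le_card fun j => ?_
  simp only [Finset.mem_filter, Finset.mem_univ, true_and]
  rintro ⟨h1, h2⟩
  refine ⟨lt_of_le_of_ne ((hi_le_iff k j).2 h1) ?_, h2.trans h⟩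
  rintro rfl
  exact h.not_gt h2

/-- Only the entries at `lo k` and `hi k` change, from (c, d) to (d + 1, c); as c ≤ d at an ascent,
the distance is (d + 1 − c) + (d − c). -/
theorem codeWeight_self_mul_simple {x : Perm (Fin n)} {k : Fin (n - 1)} (hx : x (lo k) < x (hi k)) :
    (codeWeight x (x * simple k) : ℤ) = 2 * (code x (hi k) - code x (lo k)) + 1 := by
  have h1 := code_mul_simple hx (lo k)
  have h2 := code_mul_simple hx (hi k)
  have h3 := code_lo_le_code_hi hx
  rw [simple_lo, if_neg (lo_lt_hi k).ne] at h1
  rw [simple_hi, if_pos rfl] at h2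
  rw [codeWeight, ← Finset.sum_subset (Finset.subset_univ {lo k, hi k}),
    Finset.sum_pair (lo_lt_hi k).ne, h1, h2]
  · omega
  · intro i _ hi'
    simp only [Finset.mem_insert, Finset.mem_singleton, not_or] at hi'
    have := code_mul_simple hx i
    rw [simple_of_ne hi'.1 hi'.2, if_neg hi'.2] at this
    simp [this]

theorem code_last {m : ℕ} (w : Perm (Fin (m + 1))) : code w (Fin.last m) = 0 := by
  simp [code, (Fin.le_last _).not_gt]

/-- Summation by parts; the boundary term vanishes because the last entry of the code is zero. -/
theorem sum_mul_code_sub (w : Perm (Fin n)) :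
    ∑ k : Fin (n - 1), ((k : ℤ) + 1) * (code w (lo k) - code w (hi k)) = length w := by
  cases n with
  | zero => simp [length_eq_sum_code]
  | succ m =>
    have h1 := Fin.sum_univ_castSucc fun i : Fin (m + 1) => ((i : ℤ) + 1) * code w i
    have h2 := Fin.sum_univ_succ fun i : Fin (m + 1) => (i : ℤ) * code w i
    have h3 : (∑ i : Fin (m + 1), ((i : ℤ) + 1) * code w i) =
        ∑ i : Fin (m + 1), (i : ℤ) * code w i + ∑ i, (code w i : ℤ) := by
      rw [← Finset.sum_add_distrib]
      exact Finset.sum_congr rfl fun i _ => by ring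
    simp only [code_last, Fin.val_castSucc, Fin.val_succ, Fin.val_zero, Nat.cast_zero, mul_zero,
      zero_mul, add_zero, zero_add, Nat.cast_add, Nat.cast_one] at h1 h2
    rw [length_eq_sum_code, Nat.cast_sum]
    change ∑ k : Fin m, ((k : ℤ) + 1) * (code w k.castSucc - code w k.succ) = _
    simp only [mul_sub, Finset.sum_sub_distrib]
    linarith

theorem sum_succ_eq_choose (n : ℕ) : ∑ k : Fin (n - 1), ((k : ℤ) + 1) = n.choose 2 := by
  rw [Nat.choose_two_right, ← Finset.sum_range_id]
  cases n with
  | zero => simp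
  | succ m =>
    rw [Finset.sum_range_succ', Fin.sum_univ_eq_sum_range fun k => (k : ℤ) + 1]
    push_cast
    simp

/-- Matches the nonzero terms of DᵀU and UDᵀ off the diagonal. Conjugating the transposition by
`s_k` keeps its two positions in order unless they are `lo k` and `hi k`, and that case would force
`u = v`. Comparing lengths then determines whether `k` is an ascent or a descent. -/
theorem strong_exchange {u v : Perm (Fin n)} (huv : u ≠ v) (k : Fin (n - 1)) :
    (u (hi k) < u (lo k) ∧ StrongCover (u * simple k) v) ↔
      (v (lo k) < v (hi k) ∧ StrongCover u (v * simple k)) := by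
  have conj : ∀ {x : Perm (Fin n)} {a b : Fin n},
      x * simple k * swap (simple k a) (simple k b) = x * swap a b * simple k := by
    intro x a b
    rw [swap_apply_apply, simple_inv]
    simp only [mul_assoc, simple_mul_simple_mul]
  constructor
  · rintro ⟨hu, ⟨a, b, hab, hv⟩, hl⟩
    have hlu := length_mul_simple' hu
    have hne : ¬(a = lo k ∧ b = hi k) := by
      rintro ⟨rfl, rfl⟩
      exact huv ((mul_simple_simple u k).symm.trans hv.symm)
    have hab' := simple_lt_simple hab hne
    have he : v * simple k = u * swap (simple k a) (simple k b) := by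
      rw [hv, ← conj, mul_simple_simple]
    have hxab : (u * simple k) a < (u * simple k) b :=
      (length_lt_mul_swap_iff hab).1 (by rw [← hv]; omega)
    have hlt : length u < length (v * simple k) := by
      rw [he]; exact length_lt_mul_swap hab' hxab
    have hvk : v (lo k) < v (hi k) := length_lt_mul_simple_iff.1 (by omega)
    have := length_mul_simple hvk
    exact ⟨hvk, ⟨_, _, hab', he⟩, by omega⟩
  · rintro ⟨hv, ⟨a, b, hab, he⟩, hl⟩
    have hlv := length_mul_simple hv
    have hne : ¬(a = lo k ∧ b = hi k) := by
      rintro ⟨rfl, rfl⟩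
      exact huv (mul_right_cancel he).symm
    have hab' := simple_lt_simple hab hne
    have he' : v = u * simple k * swap (simple k a) (simple k b) := by
      rw [conj, ← he, mul_simple_simple]
    have huab : u a < u b := (length_lt_mul_swap_iff hab).1 (by rw [← he]; omega)
    have hlt : length (u * simple k) < length v := by
      rw [he']; exact length_lt_mul_swap hab' (by simpa using huab)
    have huk : u (hi k) < u (lo k) := length_mul_simple_lt_iff.1 (by omega)
    have := length_mul_simple' huk
    exact ⟨huk, ⟨_, _, hab', he'⟩, by omega⟩

theorem strongCover_mul_simple {w : Perm (Fin n)} {k : Fin (n - 1)} (h : w (lo k) < w (hi k)) :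
    StrongCover w (w * simple k) :=
  ⟨⟨_, _, lo_lt_hi k, rfl⟩, length_mul_simple h⟩

open Matrix in
/-- The `sl₂` commutation relation between the weighted weak and strong orders. -/
theorem weak_strong_commutator :
    (coverMatrix WeakCover nablaWeight)ᵀ * coverMatrix StrongCover codeWeight -
      coverMatrix StrongCover codeWeight * (coverMatrix WeakCover nablaWeight)ᵀ =
    Matrix.diagonal fun u : Perm (Fin n) => 2 * (length u : ℤ) - n.choose 2 := by
  ext u v
  have h1 := sum_weak_mul' u fun w => (coverMatrix StrongCover codeWeight w v : ℤ)
  have h2 := sum_weak_mul v fun w => (coverMatrix StrongCover codeWeight u w : ℤ)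
  simp only [Int.cast_id] at h1 h2
  simp only [Matrix.sub_apply, Matrix.mul_apply, Matrix.transpose_apply]
  simp only [mul_comm (coverMatrix StrongCover codeWeight u _)]
  rw [h1, h2, ← Finset.sum_sub_distrib]
  by_cases huv : u = v
  · subst huv
    rw [Matrix.diagonal_apply_eq, ← sum_mul_code_sub, ← sum_succ_eq_choose, Finset.mul_sum,
      ← Finset.sum_sub_distrib]
    refine Finset.sum_congr rfl fun k _ => ?_
    -- Both cases contribute the same amount, (k + 1)(2(c_lo − c_hi) − 1) with c the code of `u`:
    -- the sign of the commutator absorbs the difference.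
    rcases ascent_or_descent u k with h | h
    · rw [if_neg h.not_gt, if_pos h, coverMatrix, Matrix.of_apply,
        if_pos (strongCover_mul_simple h), codeWeight_self_mul_simple h]
      ring
    · have h' : (u * simple k) (lo k) < (u * simple k) (hi k) := by simpa using h
      have hc := strongCover_mul_simple h'
      have hw := codeWeight_self_mul_simple h'
      have c1 := code_mul_simple h' (lo k)
      have c2 := code_mul_simple h' (hi k)
      rw [mul_simple_simple] at hc hw c1 c2
      rw [simple_lo, if_neg (lo_lt_hi k).ne] at c1
      rw [simple_hi, if_pos rfl] at c2
      rw [if_pos h, if_neg h.not_gt, coverMatrix, Matrix.of_apply, if_pos hc, hw, c1, c2]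
      push_cast
      ring
  · rw [Matrix.diagonal_apply_ne _ huv]
    refine Finset.sum_eq_zero fun k _ => ?_
    have hex := strong_exchange huv k
    simp only [coverMatrix, Matrix.of_apply, mul_ite, mul_zero, ← ite_and]
    by_cases h : v (lo k) < v (hi k) ∧ StrongCover u (v * simple k)
    · have h' := hex.2 h
      have h3 := codeWeight_mul_simple (x := u * simple k) (v := v) (k := k)
        (by simpa using h'.1) h.1
      rw [mul_simple_simple] at h3
      rw [if_pos h, if_pos h', h3, sub_self]
    · rw [if_neg h, if_neg (mt hex.1 h), sub_self]

/-! ### Weighted chains as matrix powers. -/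

section Paths

variable {α : Type*} [Fintype α]

theorem mem_chains {cov : α → α → Prop} {x y : α} {k : ℕ} {c : Fin (k + 1) → α} :
    c ∈ chains cov x y k ↔
      c 0 = x ∧ c (Fin.last k) = y ∧ ∀ i : Fin k, cov (c i.castSucc) (c i.succ) := by
  simp [chains]

variable [DecidableEq α]

/-- Weighted chains with `k` steps are counted by the `k`-th power of the weight matrix. -/
theorem coverMatrix_pow (cov : α → α → Prop) (wt : α → α → ℕ) (k : ℕ) (x y : α) :
    (coverMatrix cov wt ^ k) x y =
      ((∑ c ∈ chains cov x y k, ∏ i : Fin k, wt (c i.castSucc) (c i.succ) : ℕ) : ℤ) := by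
  induction k generalizing x with
  | zero =>
    rw [pow_zero, Matrix.one_apply]
    simp only [Finset.univ_eq_empty, Finset.prod_empty, Finset.sum_const, smul_eq_mul, mul_one]
    split_ifs with h
    · subst h
      symm
      rw [Nat.cast_eq_one, Finset.card_eq_one]
      refine ⟨fun _ => x, ?_⟩
      ext c
      rw [mem_chains, Finset.mem_singleton]
      constructor
      · rintro ⟨h, -⟩
        funext i
        rw [← h, Fin.fin_one_eq_zero i]
      · rintro rfl
        exact ⟨rfl, rfl, fun i => i.elim0⟩
    · symm
      rw [Nat.cast_eq_zero, Finset.card_eq_zero, Finset.eq_empty_iff_forall_notMem]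
      intro c hc
      rw [mem_chains] at hc
      exact h (hc.1.symm.trans hc.2.1)
  | succ k ih =>
    classical
    rw [pow_succ', Matrix.mul_apply]
    simp only [ih, chains, Finset.sum_filter]
    symm
    -- A chain is split into its first element, forced to be `x`, and the remaining chain, whose
    -- first element is the summation index of the matrix product.
    rw [← (Fin.consEquiv fun _ : Fin (k + 2) => α).sum_comp, Fintype.sum_prod_type,
      Finset.sum_eq_single x]
    · push_cast
      simp only [Finset.mul_sum]
      rw [Finset.sum_comm]
      refine Finset.sum_congr rfl fun c _ => ?_
      rw [Finset.sum_eq_single (c 0)]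
      · simp only [coverMatrix, Matrix.of_apply, Fin.consEquiv_apply, Fin.cons_zero, true_and,
          Fin.forall_fin_succ, Fin.prod_univ_succ, Fin.castSucc_zero, Fin.cons_succ,
          ← Fin.succ_castSucc, ← Fin.succ_last]
        by_cases h1 : cov x (c 0) <;> simp [h1]
      · intro z _ hz
        rw [if_neg (fun h => hz h.1.symm), mul_zero]
      · simp
    · intro z _ hz
      refine Finset.sum_eq_zero fun c _ => if_neg ?_
      rintro ⟨h, -⟩
      exact hz h
    · simp

/-- In a graded poset only chains of one length join two given elements. -/
theorem coverMatrix_pow_eq_zero {cov : α → α → Prop} {wt : α → α → ℕ} {rk : α → ℕ}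
    (hrk : ∀ x y, cov x y → rk y = rk x + 1) {k : ℕ} {x y : α} (h : rk y ≠ rk x + k) :
    (coverMatrix cov wt ^ k) x y = 0 := by
  induction k generalizing x with
  | zero => exact Matrix.one_apply_ne fun e => h (by rw [e, add_zero])
  | succ k ih =>
    rw [pow_succ', Matrix.mul_apply]
    refine Finset.sum_eq_zero fun z _ => ?_
    by_cases hc : cov x z
    · rw [ih (by have := hrk _ _ hc; omega), mul_zero]
    · rw [coverMatrix, Matrix.of_apply, if_neg hc, zero_mul]

theorem weightedPaths_eq_pow {cov : α → α → Prop} {wt : α → α → ℕ} {rk : α → ℕ}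
    (hrk : ∀ x y, cov x y → rk y = rk x + 1) {x y : α} {k : ℕ} (hk : rk x + k = rk y)
    (hcard : k < Fintype.card α) :
    (weightedPaths cov wt x y : ℤ) = (coverMatrix cov wt ^ k) x y := by
  rw [weightedPaths, Nat.cast_sum, Finset.sum_eq_single k, coverMatrix_pow]
  · intro l _ hl
    rw [← coverMatrix_pow, coverMatrix_pow_eq_zero hrk]
    omega
  · intro h
    exact absurd (Finset.mem_range.2 hcard) h

/-- An order-reversing involution that preserves the weights reverses weighted chains. -/
theorem coverMatrix_pow_antiautomorphism {cov : α → α → Prop} {wt : α → α → ℕ} (e : α ≃ α)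
    (hcov : ∀ x y, cov (e y) (e x) ↔ cov x y) (hwt : ∀ x y, cov x y → wt (e y) (e x) = wt x y)
    (k : ℕ) (x y : α) :
    (coverMatrix cov wt ^ k) (e y) (e x) = (coverMatrix cov wt ^ k) x y := by
  induction k generalizing x with
  | zero => simp [Matrix.one_apply, eq_comm]
  | succ k ih =>
    -- The reversed chain is split at its last step, the original one at its first.
    rw [show coverMatrix cov wt ^ (k + 1) = coverMatrix cov wt ^ k * coverMatrix cov wt from
      pow_succ _ _, Matrix.mul_apply, ← pow_succ, pow_succ', Matrix.mul_apply, ← e.sum_comp]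
    refine Finset.sum_congr rfl fun z _ => ?_
    rw [ih, mul_comm]
    congr 1
    simp only [coverMatrix, Matrix.of_apply]
    by_cases h : cov x z
    · rw [if_pos h, if_pos ((hcov x z).2 h), hwt x z h]
    · rw [if_neg h, if_neg (mt (hcov x z).1 h)]

end Paths

/-! ### Path counts in the symmetric group and their symmetry under `w₀`. -/

/-- Guarantees that the cutoff at the cardinality n! in `weightedPaths` loses no chain, since no
chain has more than N steps. -/
theorem choose_two_lt_factorial (n : ℕ) : n.choose 2 < n.factorial := by
  induction n with
  | zero => simp
  | succ m ih =>
    rw [Nat.choose_succ_succ' m 1, one_add_one_eq_two, Nat.choose_one_right, Nat.factorial_succ,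
      add_mul, one_mul]
    have := Nat.le_mul_of_pos_right m m.factorial_pos
    omega

theorem weakCover_rank (x y : Perm (Fin n)) (h : WeakCover x y) : length y = length x + 1 := h.2

theorem strongCover_rank (x y : Perm (Fin n)) (h : StrongCover x y) : length y = length x + 1 := h.2

theorem lt_card_of_length {x y : Perm (Fin n)} {k : ℕ} (hk : length x + k = length y) :
    k < Fintype.card (Perm (Fin n)) := by
  rw [Fintype.card_perm, Fintype.card_fin]
  have := length_le y
  have := choose_two_lt_factorial n
  omega

theorem mDelta_eq_pow {x y : Perm (Fin n)} {k : ℕ} (hk : length x + k = length y) :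
    (mDelta x y : ℤ) = (coverMatrix StrongCover codeWeight ^ k) x y :=
  weightedPaths_eq_pow strongCover_rank hk (lt_card_of_length hk)

theorem mNabla_eq_pow {x y : Perm (Fin n)} {k : ℕ} (hk : length x + k = length y) :
    (mNabla x y : ℤ) = (coverMatrix WeakCover nablaWeight ^ k) x y :=
  weightedPaths_eq_pow weakCover_rank hk (lt_card_of_length hk)

theorem length_longest_mul_eq_add_one_iff {x y : Perm (Fin n)} :
    length (longest n * x) = length (longest n * y) + 1 ↔ length y = length x + 1 := by
  have := length_add_length_longest_mul x
  have := length_add_length_longest_mul y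
  omega

theorem weakCover_longest_mul_iff (x y : Perm (Fin n)) :
    WeakCover (longest n * y) (longest n * x) ↔ WeakCover x y := by
  simp only [WeakCover, length_longest_mul_eq_add_one_iff, mul_assoc, mul_right_inj]
  refine and_congr_left' (exists_congr fun i => ?_)
  constructor <;> rintro rfl <;> simp

theorem strongCover_longest_mul_iff (x y : Perm (Fin n)) :
    StrongCover (longest n * y) (longest n * x) ↔ StrongCover x y := by
  simp only [StrongCover, length_longest_mul_eq_add_one_iff, mul_assoc, mul_right_inj]
  refine and_congr_left' (exists_congr fun i => exists_congr fun j => and_congr_right' ?_)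
  constructor <;> rintro rfl <;> simp [mul_assoc]

theorem nablaWeight_longest_mul (x y : Perm (Fin n)) :
    nablaWeight (longest n * y) (longest n * x) = nablaWeight x y := by
  simp only [nablaWeight, mul_assoc, mul_right_inj]
  refine Finset.sum_congr rfl fun i _ => if_congr ?_ rfl rfl
  constructor <;> rintro rfl <;> simp

theorem codeWeight_longest_mul (x y : Perm (Fin n)) :
    codeWeight (longest n * y) (longest n * x) = codeWeight x y := by
  refine Finset.sum_congr rfl fun i _ => ?_
  have := code_add_code_longest_mul x i
  have := code_add_code_longest_mul y i
  omega

theorem mDelta_longest_mul (u : Perm (Fin n)) :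
    mDelta 1 (longest n * u) = mDelta u (longest n) := by
  have h := length_add_length_longest_mul u
  zify
  rw [mDelta_eq_pow (k := length (longest n * u)) (by rw [length_one, zero_add]),
    mDelta_eq_pow (k := length (longest n * u)) (by rw [length_longest, h]),
    ← coverMatrix_pow_antiautomorphism (Equiv.mulLeft (longest n)) strongCover_longest_mul_iff
      fun x y _ => codeWeight_longest_mul x y]
  simp [longest_mul_longest_mul]

theorem mNabla_longest_mul (u : Perm (Fin n)) :
    mNabla (longest n * u) (longest n) = mNabla 1 u := by
  have h := length_add_length_longest_mul u
  zify
  rw [mNabla_eq_pow (k := length u) (by rw [length_longest, add_comm, h]),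
    mNabla_eq_pow (k := length u) (by rw [length_one, zero_add]),
    ← coverMatrix_pow_antiautomorphism (Equiv.mulLeft (longest n)) weakCover_longest_mul_iff
      fun x y _ => nablaWeight_longest_mul x y]
  simp [longest_mul_longest, longest_mul_longest_mul]

/-! ### From the weak recurrence to both path counts. -/

theorem eq_one_of_length_eq_zero {u : Perm (Fin n)} (h : length u = 0) : u = 1 :=
  eq_one_of_forall_ascent fun k => (ascent_or_descent u k).resolve_right fun hk => by
    have := length_mul_simple' hk
    omega

open Matrix in
/-- A function that satisfies the recurrence of the weak order satisfies that of the strong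
order. -/
theorem sum_strong_mul_eq {R : Type*} [Field R] [CharZero R] {f : Perm (Fin n) → R}
    (hf : ∀ u, ∑ w, ((coverMatrix WeakCover nablaWeight w u : ℤ) : R) * f w = length u * f u)
    (u : Perm (Fin n)) :
    ∑ v, ((coverMatrix StrongCover codeWeight u v : ℤ) : R) * f v =
      (n.choose 2 - length u : R) * f u := by
  set D : Matrix (Perm (Fin n)) (Perm (Fin n)) R :=
    (coverMatrix WeakCover nablaWeight).map (Int.castRingHom R) with hD
  set U : Matrix (Perm (Fin n)) (Perm (Fin n)) R :=
    (coverMatrix StrongCover codeWeight).map (Int.castRingHom R) with hU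
  have hf' : Dᵀ *ᵥ f = fun u => (length u : R) * f u := funext hf
  have hcomm : Dᵀ * U = U * Dᵀ +
      Matrix.diagonal fun u : Perm (Fin n) => 2 * (length u : R) - n.choose 2 := by
    have h := congrArg (fun M => M.map (Int.castRingHom R))
      (sub_eq_iff_eq_add'.1 (weak_strong_commutator (n := n)))
    simp only [Matrix.map_mul, Matrix.map_add _ (map_add (Int.castRingHom R)),
      Matrix.diagonal_map (map_zero (Int.castRingHom R)), Matrix.transpose_map] at h
    rw [h]
    congr 2
    funext u
    simp
  -- The commutator applied to `f`: in U(ℓ·f) at `u` only elements of length ℓ(u) + 1 occur, so ℓ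
  -- becomes a constant factor.
  have hrec : ∀ u, (Dᵀ *ᵥ (U *ᵥ f)) u =
      (length u + 1 : R) * (U *ᵥ f) u + (2 * length u - n.choose 2 : R) * f u := by
    intro u
    rw [Matrix.mulVec_mulVec, hcomm, Matrix.add_mulVec, ← Matrix.mulVec_mulVec, hf', Pi.add_apply,
      Matrix.mulVec_diagonal]
    congr 1
    simp only [Matrix.mulVec, dotProduct, Finset.mul_sum]
    refine Finset.sum_congr rfl fun v _ => ?_
    by_cases h : StrongCover u v
    · rw [h.2]; push_cast; ring
    · simp [hU, coverMatrix, h]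
  change (U *ᵥ f) u = _
  induction hl : length u using Nat.strong_induction_on generalizing u with
  | _ l ih =>
    -- The same quantity through the induction hypothesis: the lower covers have length `l - 1`,
    -- hence the factor N − l + 1. No base case is needed, both sides being zero for `l = 0`.
    have h1 : (Dᵀ *ᵥ (U *ᵥ f)) u = (n.choose 2 - l + 1 : R) * (l * f u) := by
      rw [← hl, ← hf u, Finset.mul_sum]
      refine Finset.sum_congr rfl fun w _ => ?_
      by_cases h : WeakCover w u
      · have h2 := h.2
        rw [ih (length w) (by omega) w rfl, h2]
        simp only [hD, Matrix.transpose_apply, Matrix.map_apply, eq_intCast]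
        push_cast
        ring
      · simp [hD, coverMatrix, h]
    rw [hrec, hl] at h1
    have h0 : (l + 1 : R) ≠ 0 := by exact_mod_cast Nat.succ_ne_zero l
    apply mul_left_cancel₀ h0
    linear_combination h1

/-- Weighted strong chains to the longest element, in terms of a function that satisfies the
recurrence of the weak order. -/
theorem mDelta_longest_eq {R : Type*} [Field R] [CharZero R] {f : Perm (Fin n) → R}
    (hf : ∀ u, ∑ w, ((coverMatrix WeakCover nablaWeight w u : ℤ) : R) * f w = length u * f u)
    (h1 : f (longest n) = 1) (u : Perm (Fin n)) :
    (mDelta u (longest n) : R) = (n.choose 2 - length u).factorial * f u := by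
  have key : ∀ k (u : Perm (Fin n)), length u + k = length (longest n) →
      (((coverMatrix StrongCover codeWeight ^ k) u (longest n) : ℤ) : R) = k.factorial * f u := by
    intro k
    induction k with
    | zero =>
      intro u hu
      have : longest n * u = 1 := by
        have h := length_add_length_longest_mul u
        rw [length_longest] at hu
        exact eq_one_of_length_eq_zero (by omega)
      obtain rfl : u = longest n := by rw [← longest_mul_longest_mul u, this, mul_one]
      simp [h1]
    | succ k ih =>
      intro u hu
      have hs := sum_strong_mul_eq hf u
      have hN : (n.choose 2 : R) = length u + (k + 1) := by
        rw [← length_longest, ← hu]; push_cast; ring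
      rw [hN, add_sub_cancel_left] at hs
      rw [Nat.factorial_succ, pow_succ', Matrix.mul_apply]
      push_cast
      -- One application of the strong recurrence supplies the factor N − ℓ(u) = k + 1.
      rw [mul_comm (k + 1 : R), mul_assoc, ← hs, Finset.mul_sum]
      refine Finset.sum_congr rfl fun v _ => ?_
      by_cases h : StrongCover u v
      · rw [ih v (by have := h.2; omega)]; ring
      · simp [coverMatrix, h]
  have hle := length_le u
  have hk : length u + (n.choose 2 - length u) = length (longest n) := by
    rw [length_longest]; omega
  rw [← key _ u hk, ← mDelta_eq_pow hk, Int.cast_natCast]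

/-- Weighted weak chains from the identity, in terms of a function that satisfies the recurrence
of the weak order. -/
theorem mNabla_one_eq {R : Type*} [CommRing R] {f : Perm (Fin n) → R}
    (hf : ∀ u, ∑ w, ((coverMatrix WeakCover nablaWeight w u : ℤ) : R) * f w = length u * f u)
    (h1 : f 1 = 1) (u : Perm (Fin n)) :
    (mNabla 1 u : R) = (length u).factorial * f u := by
  have key : ∀ k (u : Perm (Fin n)), k = length u →
      (((coverMatrix WeakCover nablaWeight ^ k) 1 u : ℤ) : R) = k.factorial * f u := by
    intro k
    induction k with
    | zero =>
      intro u hu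
      obtain rfl := eq_one_of_length_eq_zero hu.symm
      simp [h1]
    | succ k ih =>
      intro u hu
      have hs := hf u
      rw [← hu] at hs
      rw [Nat.factorial_succ, mul_comm (k + 1), Nat.cast_mul, mul_assoc, ← hs, Finset.mul_sum,
        pow_succ, Matrix.mul_apply]
      push_cast
      refine Finset.sum_congr rfl fun v _ => ?_
      by_cases h : WeakCover v u
      · rw [ih v (by have := h.2; omega)]; ring
      · simp [coverMatrix, h]
  rw [← key _ u rfl, ← mNabla_eq_pow (by rw [length_one, zero_add]), Int.cast_natCast]

/-! ### Divided differences and their braid relations. -/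

open MvPolynomial

theorem X_lo_sub_X_hi_ne_zero (k : Fin (n - 1)) :
    (X (lo k) - X (hi k) : MvPolynomial (Fin n) ℂ) ≠ 0 := by
  rw [sub_ne_zero]
  exact fun h => (lo_lt_hi k).ne (X_injective h)

/-- Replaces the chosen quotient by its characterization: the divisor is nonzero in a domain. -/
theorem dividedDifference_eq_of_mul {k : Fin (n - 1)} {g h : MvPolynomial (Fin n) ℂ}
    (e : (X (lo k) - X (hi k)) * h = g - rename (simple k) g) : dividedDifference k g = h :=
  mul_left_cancel₀ (X_lo_sub_X_hi_ne_zero k) ((dividedDifference_spec k g).trans e.symm)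

theorem rename_rename_simple (k : Fin (n - 1)) (g : MvPolynomial (Fin n) ℂ) :
    rename (simple k) (rename (simple k) g) = g := by
  rw [rename_rename]
  have : (simple k : Fin n → Fin n) ∘ simple k = id := funext (simple_simple k)
  rw [this, rename_id_apply]

/-- Applying `s_k` to the defining equation changes the sign of both `x_k - x_{k+1}` and the
right-hand side. -/
theorem rename_dividedDifference (k : Fin (n - 1)) (g : MvPolynomial (Fin n) ℂ) :
    rename (simple k) (dividedDifference k g) = dividedDifference k g := by
  have h := congrArg (rename (simple k)) (dividedDifference_spec k g)
  rw [map_mul, map_sub, map_sub, rename_rename_simple, rename_X, rename_X, simple_lo,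
    simple_hi] at h
  exact (dividedDifference_eq_of_mul (by linear_combination -h)).symm

theorem dividedDifference_of_rename_eq {k : Fin (n - 1)} {g : MvPolynomial (Fin n) ℂ}
    (h : rename (simple k) g = g) : dividedDifference k g = 0 :=
  dividedDifference_eq_of_mul (by rw [h, mul_zero, sub_self])

theorem dividedDifference_dividedDifference (k : Fin (n - 1)) (g : MvPolynomial (Fin n) ℂ) :
    dividedDifference k (dividedDifference k g) = 0 :=
  dividedDifference_of_rename_eq (rename_dividedDifference k g)

/-- The divided difference as a linear map. -/
noncomputable def dividedDifferenceLinear (k : Fin (n - 1)) :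
    MvPolynomial (Fin n) ℂ →ₗ[ℂ] MvPolynomial (Fin n) ℂ where
  toFun := dividedDifference k
  map_add' f g := dividedDifference_eq_of_mul (by
    rw [mul_add, dividedDifference_spec, dividedDifference_spec, map_add]; ring)
  map_smul' c g := dividedDifference_eq_of_mul (by
    rw [RingHom.id_apply, mul_smul_comm, dividedDifference_spec, map_smul, smul_sub])

theorem simple_lo_of_far {i j : Fin (n - 1)} (h : (i : ℕ) + 1 < j ∨ (j : ℕ) + 1 < i) :
    simple i (lo j) = lo j :=
  simple_of_ne (by simp only [ne_eq, Fin.ext_iff, lo]; omega)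
    (by simp only [ne_eq, Fin.ext_iff, lo, hi]; omega)

theorem simple_hi_of_far {i j : Fin (n - 1)} (h : (i : ℕ) + 1 < j ∨ (j : ℕ) + 1 < i) :
    simple i (hi j) = hi j :=
  simple_of_ne (by simp only [ne_eq, Fin.ext_iff, lo, hi]; omega)
    (by simp only [ne_eq, Fin.ext_iff, hi]; omega)

theorem simple_hi_of_succ {i j : Fin (n - 1)} (h : (j : ℕ) = i + 1) : simple i (hi j) = hi j :=
  simple_of_ne (by simp only [ne_eq, Fin.ext_iff, lo, hi]; omega)
    (by simp only [ne_eq, Fin.ext_iff, hi]; omega)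

theorem simple_lo_of_succ {i j : Fin (n - 1)} (h : (j : ℕ) = i + 1) : simple j (lo i) = lo i :=
  simple_of_ne (by simp only [ne_eq, Fin.ext_iff, lo]; omega)
    (by simp only [ne_eq, Fin.ext_iff, lo, hi]; omega)

theorem simple_braid {i j : Fin (n - 1)} (h : (j : ℕ) = i + 1) :
    simple i * simple j * simple i = simple j * simple i * simple j := by
  have hh : lo j = hi i := Fin.ext h
  have h1 := swap_apply_apply (simple i) (lo j) (hi j)
  have h2 := swap_apply_apply (simple j) (lo i) (hi i)
  rw [simple_hi_of_succ h, hh, simple_hi, ← hh, simple_inv] at h1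
  rw [simple_lo_of_succ h, ← hh, simple_lo, hh, simple_inv] at h2
  rw [hh] at h1
  exact (by simpa only [simple, hh] using h1.symm.trans h2)

theorem simple_comm {i j : Fin (n - 1)} (h : (i : ℕ) + 1 < j) :
    simple i * simple j = simple j * simple i := by
  have h1 := swap_apply_apply (simple i) (lo j) (hi j)
  rw [simple_lo_of_far (Or.inl h), simple_hi_of_far (Or.inl h), simple_inv] at h1
  change simple j = simple i * simple j * simple i at h1
  conv_rhs => rw [h1]
  simp

/-- The Newton divided differences satisfy the braid relation. -/
theorem dividedDifference_braid {i j : Fin (n - 1)} (hij : (j : ℕ) = i + 1)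
    (g : MvPolynomial (Fin n) ℂ) :
    dividedDifference i (dividedDifference j (dividedDifference i g)) =
      dividedDifference j (dividedDifference i (dividedDifference j g)) := by
  have hh : lo j = hi i := Fin.ext hij
  have hs := simple_hi_of_succ hij
  have ht := simple_lo_of_succ hij
  have ht1 : simple j (hi i) = hi j := by rw [← hh, simple_lo]
  have ht2 : simple j (hi j) = hi i := by rw [← hh, simple_hi]
  have hst : rename (simple i) (rename (simple j) (rename (simple i) g)) =
      rename (simple j) (rename (simple i) (rename (simple j) g)) := by
    simp only [rename_rename, ← Perm.coe_mul]
    rw [← mul_assoc, ← mul_assoc, simple_braid hij]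
  have hac : (X (lo i) - X (hi j) : MvPolynomial (Fin n) ℂ) ≠ 0 := by
    rw [sub_ne_zero]
    intro h
    have := X_injective h
    simp only [Fin.ext_iff, lo, hi] at this
    omega
  have p1 := dividedDifference_spec i g
  have p2 := dividedDifference_spec j (dividedDifference i g)
  have p3 := dividedDifference_spec i (dividedDifference j (dividedDifference i g))
  have q1 := dividedDifference_spec j g
  have q2 := dividedDifference_spec i (dividedDifference j g)
  have q3 := dividedDifference_spec j (dividedDifference i (dividedDifference j g))
  have fp1 := rename_dividedDifference i g
  have fq1 := rename_dividedDifference j g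
  have sp2 := congrArg (rename (simple i)) p2
  have tp1 := congrArg (rename (simple j)) p1
  have stp1 := congrArg (rename (simple i)) tp1
  have tq2 := congrArg (rename (simple j)) q2
  have sq1 := congrArg (rename (simple i)) q1
  have tsq1 := congrArg (rename (simple j)) sq1
  simp only [map_mul, map_sub, rename_X, simple_lo, simple_hi, hh, hs, ht, ht1, ht2, fp1, fq1]
    at p1 p2 p3 q1 q2 q3 sp2 tp1 stp1 tq2 sq1 tsq1
  apply mul_left_cancel₀ (mul_ne_zero (mul_ne_zero (X_lo_sub_X_hi_ne_zero i)
    (X_lo_sub_X_hi_ne_zero j)) hac)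
  rw [hh]
  set a := (X (lo i) : MvPolynomial (Fin n) ℂ)
  set b := (X (hi i) : MvPolynomial (Fin n) ℂ)
  set c := (X (hi j) : MvPolynomial (Fin n) ℂ)
  -- Cleared of denominators, either side of the braid relation is the alternating sum of the images
  -- of `g` under the six permutations of the three variables.
  have e1 : (a - b) * (b - c) * (a - c) * dividedDifference i (dividedDifference j
      (dividedDifference i g)) = g - rename (simple i) g - rename (simple j) g +
      rename (simple j) (rename (simple i) g) + rename (simple i) (rename (simple j) g) -
      rename (simple i) (rename (simple j) (rename (simple i) g)) := by
    linear_combination (b - c) * (a - c) * p3 + (a - c) * p2 - (b - c) * sp2 + p1 - tp1 + stp1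
  have e2 : (a - b) * (b - c) * (a - c) * dividedDifference j (dividedDifference i
      (dividedDifference j g)) = g - rename (simple i) g - rename (simple j) g +
      rename (simple j) (rename (simple i) g) + rename (simple i) (rename (simple j) g) -
      rename (simple j) (rename (simple i) (rename (simple j) g)) := by
    linear_combination (a - b) * (a - c) * q3 + (a - c) * q2 - (a - b) * tq2 + q1 - sq1 + tsq1
  rw [e1, e2, hst]

theorem dividedDifference_comm {i j : Fin (n - 1)} (hij : (i : ℕ) + 1 < j)
    (g : MvPolynomial (Fin n) ℂ) :
    dividedDifference i (dividedDifference j g) = dividedDifference j (dividedDifference i g) := by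
  have s1 := simple_lo_of_far (Or.inl hij : _ ∨ (j : ℕ) + 1 < i)
  have s2 := simple_hi_of_far (Or.inl hij : _ ∨ (j : ℕ) + 1 < i)
  have t1 := simple_lo_of_far (Or.inr hij : (j : ℕ) + 1 < i ∨ _)
  have t2 := simple_hi_of_far (Or.inr hij : (j : ℕ) + 1 < i ∨ _)
  have hst : rename (simple i) (rename (simple j) g) = rename (simple j) (rename (simple i) g) := by
    simp only [rename_rename, ← Perm.coe_mul]
    rw [simple_comm hij]
  have p1 := dividedDifference_spec j g
  have p2 := dividedDifference_spec i (dividedDifference j g)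
  have q1 := dividedDifference_spec i g
  have q2 := dividedDifference_spec j (dividedDifference i g)
  have sp1 := congrArg (rename (simple i)) p1
  have tq1 := congrArg (rename (simple j)) q1
  simp only [map_mul, map_sub, rename_X, s1, s2, t1, t2, hst] at sp1 tq1
  apply mul_left_cancel₀ (mul_ne_zero (X_lo_sub_X_hi_ne_zero i) (X_lo_sub_X_hi_ne_zero j))
  linear_combination (X (lo j) - X (hi j)) * p2 + p1 - sp1 - (X (lo i) - X (hi i)) * q2 - q1 + tq1

/-! ### Schubert polynomials do not depend on the chosen ascents. -/

theorem length_lt_simple_mul_iff {w : Perm (Fin n)} {k : Fin (n - 1)} :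
    length w < length (simple k * w) ↔ w⁻¹ (lo k) < w⁻¹ (hi k) := by
  rw [length_simple_mul, ← length_inv w, length_lt_mul_simple_iff]

theorem not_length_lt_simple_mul_longest (k : Fin (n - 1)) :
    ¬length (longest n) < length (simple k * longest n) := by
  rw [length_longest, not_lt]
  exact length_le _

theorem exists_length_lt_simple_mul {w : Perm (Fin n)} (h : w ≠ longest n) :
    ∃ k : Fin (n - 1), length w < length (simple k * w) := by
  by_contra! hc
  apply h
  have : w⁻¹ = longest n := eq_longest_of_forall_descent fun k =>
    (ascent_or_descent w⁻¹ k).resolve_left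
      fun hk => (length_lt_simple_mul_iff.2 hk).not_ge (hc k)
  rw [← inv_inv w, this]
  exact inv_eq_of_mul_eq_one_right longest_mul_longest

theorem schubert_longest : schubert (longest n) = ∏ i : Fin n, X i ^ (n - 1 - (i : ℕ)) := by
  rw [schubert, if_pos rfl]

/-- Downward induction on the length. -/
theorem induction_from_longest {P : Perm (Fin n) → Prop}
    (h : ∀ w, (∀ v, length w < length v → P v) → P w) (w : Perm (Fin n)) : P w := by
  induction hm : n.choose 2 - length w using Nat.strong_induction_on generalizing w with
  | _ m ih =>
    refine h w fun v hv => ih _ ?_ v rfl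
    have := length_le v
    omega

/-- The recursion for Schubert polynomials holds for every ascent. -/
theorem schubert_eq_dividedDifference {w : Perm (Fin n)} {k : Fin (n - 1)}
    (hk : length w < length (simple k * w)) :
    schubert w = dividedDifference k (schubert (simple k * w)) := by
  induction w using induction_from_longest generalizing k with
  | h w ih =>
  -- Two ascents of `w` can both be continued upwards until they meet, after three steps if adjacent
  -- and after two otherwise. The induction hypothesis applies above `w`, and the braid or
  -- commutation relation compares the two routes.
  have main : ∀ {i j : Fin (n - 1)}, i < j → length w < length (simple i * w) →
      length w < length (simple j * w) →
      dividedDifference i (schubert (simple i * w)) =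
        dividedDifference j (schubert (simple j * w)) := by
    intro i j hlt hwi hwj
    have hwi' := length_lt_simple_mul_iff.1 hwi
    have hwj' := length_lt_simple_mul_iff.1 hwj
    by_cases hij : (j : ℕ) = i + 1
    · have hh : lo j = hi i := Fin.ext hij
      have hs := simple_hi_of_succ hij
      have ht := simple_lo_of_succ hij
      have ht1 : simple j (hi i) = hi j := by rw [← hh, simple_lo]
      have hs1 : simple i (lo j) = lo i := by rw [hh, simple_hi]
      rw [hh] at hwj'
      have a1 : length (simple i * w) < length (simple j * (simple i * w)) := by
        rw [length_lt_simple_mul_iff, mul_inv_rev, simple_inv, Perm.mul_apply, Perm.mul_apply, hs1,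
          hs]
        exact hwi'.trans hwj'
      have a2 : length (simple j * (simple i * w)) <
          length (simple i * (simple j * (simple i * w))) := by
        rw [length_lt_simple_mul_iff]
        simp only [mul_inv_rev, simple_inv, Perm.mul_apply]
        rw [ht, simple_lo, ht1, hs]
        exact hwj'
      have b1 : length (simple j * w) < length (simple i * (simple j * w)) := by
        rw [length_lt_simple_mul_iff, mul_inv_rev, simple_inv, Perm.mul_apply, Perm.mul_apply, ht,
          ht1]
        exact hwi'.trans hwj'
      have b2 : length (simple i * (simple j * w)) <
          length (simple j * (simple i * (simple j * w))) := by
        rw [length_lt_simple_mul_iff]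
        simp only [mul_inv_rev, simple_inv, Perm.mul_apply]
        rw [hs1, ht, hs, simple_hi, hh]
        exact hwi'
      have hb : simple i * (simple j * (simple i * w)) =
          simple j * (simple i * (simple j * w)) := by
        simpa only [mul_assoc] using congrArg (· * w) (simple_braid hij)
      rw [ih _ hwi a1, ih _ (hwi.trans a1) a2, ih _ hwj b1, ih _ (hwj.trans b1) b2, hb,
        dividedDifference_braid hij]
    · have hij' : (i : ℕ) + 1 < j := by rw [Fin.lt_def] at hlt; omega
      have s1 := simple_lo_of_far (Or.inl hij' : _ ∨ (j : ℕ) + 1 < i)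
      have s2 := simple_hi_of_far (Or.inl hij' : _ ∨ (j : ℕ) + 1 < i)
      have t1 := simple_lo_of_far (Or.inr hij' : (j : ℕ) + 1 < i ∨ _)
      have t2 := simple_hi_of_far (Or.inr hij' : (j : ℕ) + 1 < i ∨ _)
      have a1 : length (simple i * w) < length (simple j * (simple i * w)) := by
        rw [length_lt_simple_mul_iff, mul_inv_rev, simple_inv, Perm.mul_apply, Perm.mul_apply, s1,
          s2]
        exact hwj'
      have b1 : length (simple j * w) < length (simple i * (simple j * w)) := by
        rw [length_lt_simple_mul_iff, mul_inv_rev, simple_inv, Perm.mul_apply, Perm.mul_apply, t1,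
          t2]
        exact hwi'
      have hb : simple j * (simple i * w) = simple i * (simple j * w) := by
        simpa only [mul_assoc] using congrArg (· * w) (simple_comm hij').symm
      rw [ih _ hwi a1, ih _ hwj b1, hb, dividedDifference_comm hij']
  have hne : w ≠ longest n := by
    rintro rfl
    exact not_length_lt_simple_mul_longest k hk
  have hex := exists_length_lt_simple_mul hne
  rw [schubert, if_neg hne, dif_pos hex]
  rcases lt_trichotomy hex.choose k with h | h | h
  · exact main h hex.choose_spec hk
  · rw [h]
  · exact (main h hk hex.choose_spec).symm

/-! ### Derivations and divided differences. -/

theorem dividedDifference_smul (k : Fin (n - 1)) (c : ℂ) (g : MvPolynomial (Fin n) ℂ) :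
    dividedDifference k (c • g) = c • dividedDifference k g :=
  (dividedDifferenceLinear k).map_smul c g

theorem rename_mkDerivation {f : Fin n → MvPolynomial (Fin n) ℂ} {e : Perm (Fin n)}
    (hf : ∀ j, rename e (f j) = f (e j)) (g : MvPolynomial (Fin n) ℂ) :
    rename e (mkDerivation ℂ f g) = mkDerivation ℂ f (rename e g) := by
  induction g using MvPolynomial.induction_on with
  | C r => simp
  | add p q hp hq => simp only [map_add, hp, hq]
  | mul_X p j hp =>
    simp only [Derivation.leibniz, map_add, map_mul, smul_eq_mul, mkDerivation_X, rename_X, hp, hf]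

/-- A derivation that commutes with `s_k` and scales `x_k - x_{k+1}` commutes with the divided
difference up to a scalar. -/
theorem mkDerivation_dividedDifference {f : Fin n → MvPolynomial (Fin n) ℂ} {k : Fin (n - 1)}
    (hf : ∀ j, rename (simple k) (f j) = f (simple k j)) {c : ℂ}
    (hc : f (lo k) - f (hi k) = c • (X (lo k) - X (hi k))) (g : MvPolynomial (Fin n) ℂ) :
    mkDerivation ℂ f (dividedDifference k g) =
      dividedDifference k (mkDerivation ℂ f g) - c • dividedDifference k g := by
  have h := congrArg (mkDerivation ℂ f) (dividedDifference_spec k g)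
  rw [Derivation.leibniz, map_sub, map_sub, mkDerivation_X, mkDerivation_X, hc,
    ← rename_mkDerivation hf] at h
  rw [eq_sub_iff_add_eq]
  refine (dividedDifference_eq_of_mul ?_).symm
  rw [← h]
  simp only [smul_eq_mul, mul_add, mul_smul_comm]
  rw [mul_comm (dividedDifference k g)]

/-- The sum of the partial derivatives. -/
noncomputable def nabla : Derivation ℂ (MvPolynomial (Fin n) ℂ) (MvPolynomial (Fin n) ℂ) :=
  mkDerivation ℂ fun _ => 1

/-- The Euler derivation, which multiplies a homogeneous polynomial by its degree. -/
noncomputable def euler : Derivation ℂ (MvPolynomial (Fin n) ℂ) (MvPolynomial (Fin n) ℂ) :=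
  mkDerivation ℂ X

theorem nabla_dividedDifference (k : Fin (n - 1)) (g : MvPolynomial (Fin n) ℂ) :
    nabla (dividedDifference k g) = dividedDifference k (nabla g) := by
  rw [nabla, mkDerivation_dividedDifference (c := 0) (by simp) (by simp), zero_smul, sub_zero]

theorem euler_dividedDifference (k : Fin (n - 1)) (g : MvPolynomial (Fin n) ℂ) :
    euler (dividedDifference k g) = dividedDifference k (euler g) - dividedDifference k g := by
  rw [euler, mkDerivation_dividedDifference (c := 1) (by simp) (by simp), one_smul]

/-- The operators ∂/∂x_i and x_i ∂/∂x_i agree where x_i = 1. -/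
theorem eval_one_nabla (g : MvPolynomial (Fin n) ℂ) :
    eval (fun _ => 1) (nabla g) = eval (fun _ => 1) (euler g) := by
  induction g using MvPolynomial.induction_on with
  | C r => simp [nabla, euler]
  | add p q hp hq => simp only [map_add, hp, hq]
  | mul_X p j hp =>
    rw [nabla, euler] at *
    simp [Derivation.leibniz, hp]

/-! ### Monomials and dominant Schubert polynomials. -/

theorem monomial_sub_single_mul_X (a : Fin n →₀ ℕ) (i : Fin n) :
    (monomial (a - Finsupp.single i 1) (a i : ℂ)) * X i = (a i : ℂ) • monomial a 1 := by
  rcases Nat.eq_zero_or_pos (a i) with h | h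
  · simp [h]
  · have hle : Finsupp.single i 1 ≤ a := by
      rw [Finsupp.single_le_iff]; omega
    rw [X, monomial_mul, tsub_add_cancel_of_le hle, smul_monomial, smul_eq_mul]

theorem nabla_monomial (a : Fin n →₀ ℕ) :
    nabla (monomial a (1 : ℂ)) = ∑ i, (a i : ℂ) • monomial (a - Finsupp.single i 1) 1 := by
  rw [nabla, mkDerivation_monomial, Finsupp.sum_fintype _ _ (by simp), one_smul]
  simp [smul_monomial]

theorem euler_monomial (a : Fin n →₀ ℕ) :
    euler (monomial a (1 : ℂ)) = (∑ i, (a i : ℂ)) • monomial a 1 := by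
  rw [euler, mkDerivation_monomial, Finsupp.sum_fintype _ _ (by simp), one_smul, Finset.sum_smul]
  exact Finset.sum_congr rfl fun i _ => monomial_sub_single_mul_X a i

theorem rename_simple_monomial {a : Fin n →₀ ℕ} {k : Fin (n - 1)} (h : a (lo k) = a (hi k)) :
    rename (simple k) (monomial a (1 : ℂ)) = monomial a 1 := by
  rw [rename_monomial, ← Finsupp.equivMapDomain_eq_mapDomain]
  congr 2
  ext i
  rw [Finsupp.equivMapDomain_apply]
  change a ((simple k)⁻¹ i) = a i
  rw [simple_inv]
  by_cases h1 : i = lo k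
  · rw [h1, simple_lo, h]
  by_cases h2 : i = hi k
  · rw [h2, simple_hi, h]
  rw [simple_of_ne h1 h2]

/-- The monomial with exponent `a` is symmetric under `s_k`, so it factors out, and N_k x_k = 1. -/
theorem dividedDifference_monomial {a : Fin n →₀ ℕ} {k : Fin (n - 1)} (h : a (lo k) = a (hi k)) :
    dividedDifference k (monomial (a + Finsupp.single (lo k) 1) (1 : ℂ)) = monomial a 1 := by
  apply dividedDifference_eq_of_mul
  have e : monomial (a + Finsupp.single (lo k) 1) (1 : ℂ) = monomial a 1 * X (lo k) := by
    rw [X, monomial_mul, mul_one]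
  rw [e, map_mul, rename_simple_monomial h, rename_X, simple_lo]
  ring

/-- The code as an exponent vector. -/
noncomputable def codeExponent (w : Perm (Fin n)) : Fin n →₀ ℕ :=
  Finsupp.equivFunOnFinite.symm (code w)

theorem codeExponent_apply (w : Perm (Fin n)) (i : Fin n) : codeExponent w i = code w i := rfl

theorem code_longest (i : Fin n) : code (longest n) i = n - 1 - i := by
  have := code_add_code_longest_mul (1 : Perm (Fin n)) i
  rwa [code_one, zero_add, mul_one] at this

theorem schubert_longest_eq_monomial :
    schubert (longest n) = monomial (codeExponent (longest n)) 1 := by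
  rw [schubert_longest, monomial_eq, Finsupp.prod_fintype _ _ (by simp), C_1, one_mul]
  exact Finset.prod_congr rfl fun i _ => by rw [codeExponent_apply, code_longest]

theorem longest_inv : (longest n)⁻¹ = longest n := inv_eq_of_mul_eq_one_right longest_mul_longest

/-- The Schubert polynomial of a permutation whose inverse has a weakly decreasing code is a
monomial. -/
theorem schubert_eq_monomial {w : Perm (Fin n)}
    (h : ∀ k, code w⁻¹ (hi k) ≤ code w⁻¹ (lo k)) : schubert w = monomial (codeExponent w⁻¹) 1 := by
  induction w using induction_from_longest with
  | h w ih =>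
  by_cases hw : w = longest n
  · rw [hw, longest_inv, schubert_longest_eq_monomial]
  -- The first ascent is taken so that raising the code at `lo k` keeps it weakly decreasing: the
  -- position before it is a descent, where the code drops strictly.
  obtain ⟨k, hk, hmin⟩ := WellFounded.has_min (wellFounded_lt (α := Fin (n - 1)))
    {k | w⁻¹ (lo k) < w⁻¹ (hi k)}
    ((exists_length_lt_simple_mul hw).imp fun k hk => length_lt_simple_mul_iff.1 hk)
  have hk : w⁻¹ (lo k) < w⁻¹ (hi k) := hk
  have heq : code w⁻¹ (lo k) = code w⁻¹ (hi k) := le_antisymm (code_lo_le_code_hi hk) (h k)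
  have hcode : ∀ i, code (w⁻¹ * simple k) i = code w⁻¹ i + if i = lo k then 1 else 0 := by
    intro i
    have h1 := code_mul_simple hk (simple k i)
    rw [simple_simple] at h1
    rw [h1]
    by_cases h1 : i = lo k
    · rw [h1, simple_lo, if_pos rfl, if_pos rfl, heq]
    by_cases h2 : i = hi k
    · rw [h2, simple_hi, if_neg (lo_lt_hi k).ne, if_neg (lo_lt_hi k).ne', heq]
    · rw [simple_of_ne h1 h2, if_neg h2, if_neg h1]
  have hlen := length_lt_simple_mul_iff.2 hk
  have hinv : (simple k * w)⁻¹ = w⁻¹ * simple k := by rw [mul_inv_rev, simple_inv]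
  have hexp : codeExponent (w⁻¹ * simple k) = codeExponent w⁻¹ + Finsupp.single (lo k) 1 := by
    ext i
    rw [Finsupp.add_apply, codeExponent_apply, codeExponent_apply, hcode, Finsupp.single_apply]
    simp only [eq_comm]
  rw [schubert_eq_dividedDifference hlen, ih _ hlen, hinv, hexp, dividedDifference_monomial heq]
  intro l
  rw [hinv, hcode, hcode]
  by_cases hl : hi l = lo k
  · have hlk : l < k := by
      simp only [hi, lo, Fin.ext_iff] at hl
      rw [Fin.lt_def]; omega
    have hd : w⁻¹ (hi l) < w⁻¹ (lo l) :=
      (ascent_or_descent w⁻¹ l).resolve_left fun ha => hmin l ha hlk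
    have hd' : (w⁻¹ * simple l) (lo l) < (w⁻¹ * simple l) (hi l) := by
      simpa only [Perm.mul_apply, simple_lo, simple_hi] using hd
    have c0 := code_lo_le_code_hi hd'
    have c1 := code_mul_simple hd' (lo l)
    have c2 := code_mul_simple hd' (hi l)
    rw [mul_simple_simple, simple_lo, if_neg (lo_lt_hi l).ne] at c1
    rw [mul_simple_simple, simple_hi, if_pos rfl] at c2
    rw [if_pos hl]
    omega
  · rw [if_neg hl]
    have := h l
    omega

/-- The initial value f(1) = 1: the identity has the zero code, which is weakly decreasing. -/
theorem schubert_one : schubert (1 : Perm (Fin n)) = 1 := by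
  rw [schubert_eq_monomial (by simp [code_one])]
  have : codeExponent (1 : Perm (Fin n))⁻¹ = 0 := by
    ext i; rw [inv_one, codeExponent_apply, code_one]; rfl
  rw [this]
  rfl

/-! ### The operators ∇ and Euler on Schubert polynomials. -/

theorem length_simple_mul_cases (w : Perm (Fin n)) (k : Fin (n - 1)) :
    length (simple k * w) = length w + 1 ∨ length (simple k * w) + 1 = length w := by
  rw [length_simple_mul, ← length_inv w]
  exact (ascent_or_descent w⁻¹ k).imp length_mul_simple length_mul_simple'

/-- The degree is N at `w₀`, and each divided difference lowers both degree and length by one. -/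
theorem euler_schubert (u : Perm (Fin n)) : euler (schubert u) = (length u : ℂ) • schubert u := by
  induction u using induction_from_longest with
  | h w ih =>
  by_cases hw : w = longest n
  · rw [hw, schubert_longest_eq_monomial, euler_monomial, length_eq_sum_code]
    simp [codeExponent_apply]
  · obtain ⟨k, hk⟩ := exists_length_lt_simple_mul hw
    have hl : length (simple k * w) = length w + 1 := by
      have := length_simple_mul_cases w k; omega
    rw [schubert_eq_dividedDifference hk, euler_dividedDifference, ih _ hk, hl,
      dividedDifference_smul]
    push_cast
    rw [add_smul, one_smul, add_sub_cancel_right]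

theorem dividedDifference_schubert_eq_zero {w : Perm (Fin n)} {k : Fin (n - 1)}
    (hk : length w < length (simple k * w)) : dividedDifference k (schubert w) = 0 := by
  rw [schubert_eq_dividedDifference hk, dividedDifference_dividedDifference]

/-- Neighbouring exponents of the staircase monomial differ by one, so lowering an exponent by one
is the same as applying the divided difference there. -/
theorem nabla_schubert_longest :
    nabla (schubert (longest n)) =
      ∑ k : Fin (n - 1), ((k : ℂ) + 1) • schubert (longest n * simple k) := by
  rw [schubert_longest_eq_monomial, nabla_monomial]
  cases n with
  | zero => rfl
  | succ m =>
    rw [Fin.sum_univ_castSucc, codeExponent_apply, code_last, Nat.cast_zero, zero_smul, add_zero]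
    change _ = ∑ k : Fin m, _
    -- The indices are reversed because conjugation by `w₀` reverses the simple transpositions; the
    -- exponent at the reversed position is the ∇-weight `k + 1`.
    rw [← Equiv.sum_comp Fin.revPerm]
    refine Finset.sum_congr rfl fun k _ => ?_
    let k' : Fin (m + 1 - 1) := Fin.rev k
    have hk' : (k' : ℕ) = m - (k + 1) := Fin.val_rev k
    have hkm := k.2
    have hlo : longest (m + 1) (hi (n := m + 1) k) = lo k' :=
      Fin.ext (by rw [longest_apply, Fin.val_rev]; simp only [hi, lo]; omega)
    have hhi : longest (m + 1) (lo (n := m + 1) k) = hi k' :=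
      Fin.ext (by rw [longest_apply, Fin.val_rev]; simp only [hi, lo]; omega)
    have hconj : longest (m + 1) * simple (n := m + 1) k = simple k' * longest (m + 1) := by
      have h := swap_apply_apply (longest (m + 1)) (lo (n := m + 1) k) (hi (n := m + 1) k)
      rw [hlo, hhi, swap_comm] at h
      change simple k' = _ * simple (n := m + 1) k * _ at h
      rw [h, mul_assoc _ (longest (m + 1))⁻¹, inv_mul_cancel, mul_one]
    have hlen : length (longest (m + 1) * simple (n := m + 1) k) <
        length (simple k' * (longest (m + 1) * simple (n := m + 1) k)) := by
      rw [hconj, simple_mul_simple_mul, ← hconj, length_mul_simple_lt_iff]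
      simpa [longest_apply] using lo_lt_hi (n := m + 1) k
    have hexp : codeExponent (longest (m + 1)) =
        (codeExponent (longest (m + 1)) - Finsupp.single (lo k') 1) + Finsupp.single (lo k') 1 := by
      rw [tsub_add_cancel_of_le]
      rw [Finsupp.single_le_iff, codeExponent_apply, code_longest]
      simp only [lo]; omega
    have hval : codeExponent (longest (m + 1)) (lo k') = k + 1 := by
      rw [codeExponent_apply, code_longest]
      simp only [lo]; omega
    have hval' : codeExponent (longest (m + 1)) (hi k') = k := by
      rw [codeExponent_apply, code_longest]
      simp only [hi]; omega
    change (codeExponent (longest (m + 1)) (lo k') : ℂ) •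
      monomial (codeExponent (longest (m + 1)) - Finsupp.single (lo k') 1) 1 = _
    rw [schubert_eq_dividedDifference hlen, hconj, simple_mul_simple_mul,
      schubert_longest_eq_monomial, hexp, dividedDifference_monomial, ← hexp, hval]
    · push_cast; rfl
    · simp [hval, hval', (lo_lt_hi k').ne]

/-- As ∇ commutes with N_k, the formula for u follows by applying N_k to the one for s_k u, of
greater length. -/
theorem nabla_schubert (u : Perm (Fin n)) :
    nabla (schubert u) = ∑ k : Fin (n - 1),
      if u (hi k) < u (lo k) then ((k : ℂ) + 1) • schubert (u * simple k) else 0 := by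
  induction u using induction_from_longest with
  | h u ih =>
  by_cases hu : u = longest n
  · rw [hu, nabla_schubert_longest]
    refine Finset.sum_congr rfl fun k _ => ?_
    rw [if_pos]
    simpa [longest_apply] using lo_lt_hi k
  obtain ⟨k, hk⟩ := exists_length_lt_simple_mul hu
  have hl : length (simple k * u) = length u + 1 := by
    have := length_simple_mul_cases u k; omega
  rw [schubert_eq_dividedDifference hk, nabla_dividedDifference, ih _ hk]
  change dividedDifferenceLinear k _ = _
  rw [map_sum]
  refine Finset.sum_congr rfl fun l _ => ?_
  change dividedDifference k _ = _
  have hcases := length_simple_mul_cases (u * simple l) k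
  rw [← mul_assoc] at hcases
  rcases ascent_or_descent u l with h | h
  · rw [if_neg h.not_gt]
    have h1 := length_mul_simple h
    -- A descent `l` of `s_k u` that is an ascent of `u` contributes nothing: `s_k u s_l` still has
    -- `k` as a left ascent, so N_k kills its polynomial.
    split_ifs with h2
    · have h3 := length_mul_simple' h2
      rw [dividedDifference_smul, dividedDifference_schubert_eq_zero, smul_zero]
      rw [← mul_assoc, ← mul_assoc, simple_mul_self, one_mul]
      omega
    · exact dividedDifference_of_rename_eq (map_zero _)
  · rw [if_pos h]
    have h1 := length_mul_simple' h
    -- Otherwise left multiplication by `s_k` would change the length of `u s_l` by three.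
    have h2 := (ascent_or_descent (simple k * u) l).resolve_left fun h2 => by
      have := length_mul_simple h2
      omega
    have h3 := length_mul_simple' h2
    rw [if_pos h2, dividedDifference_smul, mul_assoc, ← schubert_eq_dividedDifference]
    rw [← mul_assoc]
    omega

/-- The values of the Schubert polynomials at `(1, …, 1)` satisfy the recurrence of the weak
order. -/
theorem sum_weak_mul_eval_schubert (u : Perm (Fin n)) :
    ∑ w, ((coverMatrix WeakCover nablaWeight w u : ℤ) : ℂ) * eval (fun _ => 1) (schubert w) =
      length u * eval (fun _ => 1) (schubert u) := by
  have h := eval_one_nabla (schubert u)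
  rw [euler_schubert, nabla_schubert, smul_eval] at h
  rw [← h, sum_weak_mul', map_sum]
  refine Finset.sum_congr rfl fun k _ => ?_
  split_ifs <;> simp [smul_eval]

end BruhatPaths

/-! ### The main theorem. -/

theorem mainTheorem2 (n : ℕ) :
    (∀ u : Equiv.Perm (Fin n),
      (BruhatPaths.mDelta u (BruhatPaths.longest n) : ℂ)
            / (Nat.factorial (n.choose 2 - BruhatPaths.length u) : ℂ)
          = (BruhatPaths.mNabla 1 u : ℂ) / (Nat.factorial (BruhatPaths.length u) : ℂ) ∧
      (BruhatPaths.mNabla 1 u : ℂ) / (Nat.factorial (BruhatPaths.length u) : ℂ)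
          = MvPolynomial.eval (fun _ => (1 : ℂ)) (BruhatPaths.schubert u) ∧
      MvPolynomial.eval (fun _ => (1 : ℂ)) (BruhatPaths.schubert u)
          = (BruhatPaths.mDelta 1 (BruhatPaths.longest n * u) : ℂ)
            / (Nat.factorial (n.choose 2 - BruhatPaths.length u) : ℂ) ∧
      (BruhatPaths.mDelta 1 (BruhatPaths.longest n * u) : ℂ)
            / (Nat.factorial (n.choose 2 - BruhatPaths.length u) : ℂ)
          = (BruhatPaths.mNabla (BruhatPaths.longest n * u) (BruhatPaths.longest n) : ℂ)
            / (Nat.factorial (BruhatPaths.length u) : ℂ)) ∧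
    BruhatPaths.mDelta (1 : Equiv.Perm (Fin n)) (BruhatPaths.longest n)
      = Nat.factorial (n.choose 2) := by
  have hrec := BruhatPaths.sum_weak_mul_eval_schubert (n := n)
  have hone : MvPolynomial.eval (fun _ => (1 : ℂ))
      (BruhatPaths.schubert (1 : Equiv.Perm (Fin n))) = 1 := by
    rw [BruhatPaths.schubert_one, map_one]
  have hlongest : MvPolynomial.eval (fun _ => (1 : ℂ))
      (BruhatPaths.schubert (BruhatPaths.longest n)) = 1 := by
    rw [BruhatPaths.schubert_longest, map_prod]
    simp
  have hD := BruhatPaths.mDelta_longest_eq hrec hlongest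
  have hN := BruhatPaths.mNabla_one_eq hrec hone
  have hfac : ∀ k : ℕ, (k.factorial : ℂ) ≠ 0 := fun k => by exact_mod_cast k.factorial_ne_zero
  constructor
  · intro u
    rw [BruhatPaths.mDelta_longest_mul, BruhatPaths.mNabla_longest_mul, hD, hN,
      mul_div_cancel_left₀ _ (hfac _), mul_div_cancel_left₀ _ (hfac _)]
    exact ⟨rfl, rfl, rfl, rfl⟩
  · have h := hD 1
    rw [hone, mul_one, BruhatPaths.length_one, Nat.sub_zero] at h
    exact_mod_cast h
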